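/- **Setting.** Let $I$ be a finite set of inputs and $O$ a set of outputs, disjoint from $I$. For a label set $L$, a *computation tree* is a function $l:(2^I)^*\to L$; a *tree path* is a sequence $\pi=n_1n_2\ldots$ of nodes with $n_{m+1}=n_m\cdot e_m$, $e_m\in 2^I$. *CTL\* with inputs* has state formulas $\Phi ::= \mathrm{true}\mid\mathrm{false}\mid o\mid\neg o\mid\Phi\wedge\Phi\mid\Phi\vee\Phi\mid \mathsf A\varphi\mid \mathsf E\varphi$ ($o\in O$) and path formulas $\varphi ::= \Phi\mid i\mid\neg i\mid\varphi\wedge\varphi\mid\varphi\vee\varphi\mid \mathsf X\varphi\mid\varphi\,\mathsf U\,\varphi\mid\varphi\,\mathsf R\,\varphi$ ($i\in I$). State formulas are evaluated at nodes of a tree $l:(2^I)^*\to 2^O$ ($n\models o$ iff $o\in l(n)$; $n\models\mathsf A\varphi$ resp. $\mathsf E\varphi$ iff all resp. some tree paths from $n$ satisfy $\varphi$) and path formulas on tree paths as usual, where $\pi\models i$ iff $i\in e_1$. A state formula is *realisable* if the root of some computation tree satisfies it. An LTL formula over inputs $I$ and finite-domain outputs (with atoms "output $=$ value") is *realisable*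 if there is a computation tree, labelled with assignments to the outputs, all of whose paths from the root satisfy it; position $m$ of a path carries the label of $n_m$ and the input $e_m$. **Reduction.** Let $\Phi$ be a CTL\* state formula, and let $F_{exist}$ and $F_{univ}$ be the finite sets of its subformulas of the form $\mathsf E\varphi$ and $\mathsf A\varphi$. For each $\mathsf E\varphi\in F_{exist}$ let $A_{\varphi}$ be any nondeterministic Büchi word automaton (finitely many states, one initial state) over the alphabet $2^{I\cup O\cup\{p_\theta\,:\,\theta\in F_{exist}\cup F_{univ}\}}$ that accepts exactly the words satisfying the LTL formula obtained from $\varphi$ by replacing each maximal quantified subformula $\theta$ by the proposition $p_{\theta}$. Let $k$ be the total number of states of the automata $A_\varphi$, $\mathsf E\varphi\in F_{exist}$. Introduce, besides the outputs $O$, fresh outputs: a Boolean $p_{\mathsf A\varphi}$ for each $\mathsf A\varphi\in F_{univ}$; a variable $v_{\mathsf E\varphi}\in\{0,\ldots,k\}$ for each $\mathsf E\varphi\in F_{exist}$; and for each $j\in\{1,\ldots,k\}$ Booleans $d_{j,i}$ ($i\in I$), which encode a direction in $2^I$. Write $d_j$ for the formula $\bigwedge_{i\in I}(i\leftrightarrow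 d_{j,i})$ ("the current input is the $j$-th direction"), and $\psi'$ for the result of replacing in $\psi$ each maximal quantified subformula $\mathsf E\varphi$ by $v_{\mathsf E\varphi}\neq0$ and $\mathsf A\varphi$ by $p_{\mathsf A\varphi}$. Let $$\Phi_{LTL}\;=\;\Phi'\;\wedge\bigwedge_{\mathsf E\varphi\in F_{exist}}\ \bigwedge_{j=1}^{k}\mathsf G\big[v_{\mathsf E\varphi}=j\to(\mathsf G\,d_j\to\varphi')\big]\;\wedge\bigwedge_{\mathsf A\varphi\in F_{univ}}\mathsf G\big[p_{\mathsf A\varphi}\to\varphi'\big].$$ **Theorem.** $\Phi$ is realisable if and only if $\Phi_{LTL}$ is realisable. -/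

import Mathlib

/-! Synthesis for CTL* with inputs and for LTL, and the reduction of the former to the latter. -/

namespace CTLStarSynthesis

universe u v w

/-! ### Computation trees -/

/-- Nodes of the exhaustive tree with directions `2^I`: finite words over `2^I`;
the root is `[]` and the child of `n` in direction `e` is `n ++ [e]`. -/
abbrev Node (I : Type u) : Type u := List (Set I)

/-- Exhaustive trees with directions `2^I` and node labels in `L`. -/
abbrev CompTree (I : Type u) (L : Type v) : Type (max u v) := Node I → L

/-- Tree paths, with positions numbered from `0`. -/
def IsTreePath {I : Type u} (π : ℕ → Node I) : Prop :=
  ∀ m, ∃ e : Set I, π (m + 1) = π m ++ [e]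

/-- The suffix of a sequence from position `m` on. -/
def suffix {α : Type u} (π : ℕ → α) (m : ℕ) : ℕ → α := fun j => π (m + j)

/-! ### CTL* with inputs -/

inductive Kind : Type
  | state
  | path

/-- CTL* formulas with inputs `I` and outputs `O` in positive normal form.
`CTLStar I O .state` are the state formulas, `CTLStar I O .path` the path formulas. -/
inductive CTLStar (I : Type u) (O : Type v) : Kind → Type (max u v)
  | tt : CTLStar I O .state
  | ff : CTLStar I O .state
  | out (o : O) : CTLStar I O .state
  | nout (o : O) : CTLStar I O .state
  | and {s : Kind} (φ ψ : CTLStar I O s) : CTLStar I O s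
  | or {s : Kind} (φ ψ : CTLStar I O s) : CTLStar I O s
  | all (φ : CTLStar I O .path) : CTLStar I O .state
  | ex (φ : CTLStar I O .path) : CTLStar I O .state
  | ofState (Φ : CTLStar I O .state) : CTLStar I O .path
  | inp (i : I) : CTLStar I O .path
  | ninp (i : I) : CTLStar I O .path
  | next (φ : CTLStar I O .path) : CTLStar I O .path
  | untl (φ ψ : CTLStar I O .path) : CTLStar I O .path
  | release (φ ψ : CTLStar I O .path) : CTLStar I O .path

/-- Where a formula is evaluated: a state formula at a node, a path formula on a sequence
of nodes. -/
abbrev Point (I : Type u) : Kind → Type u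
  | .state => Node I
  | .path => ℕ → Node I

namespace CTLStar

variable {I : Type u} {O : Type v}

/-- Satisfaction in a computation tree. Inputs are read off the direction that the path takes
out of its first node. -/
def Sat (l : CompTree I (Set O)) : {s : Kind} → CTLStar I O s → Point I s → Prop
  | _, .tt, _ => True
  | _, .ff, _ => False
  | _, .out o, n => o ∈ l n
  | _, .nout o, n => o ∉ l n
  | _, .and φ ψ, x => Sat l φ x ∧ Sat l ψ x
  | _, .or φ ψ, x => Sat l φ x ∨ Sat l ψ x
  | _, .all φ, n => ∀ π : ℕ → Node I, IsTreePath π → π 0 = n → Sat l φ π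
  | _, .ex φ, n => ∃ π : ℕ → Node I, IsTreePath π ∧ π 0 = n ∧ Sat l φ π
  | _, .ofState Φ, π => Sat l Φ (π 0)
  | _, .inp i, π => ∃ e : Set I, π 1 = π 0 ++ [e] ∧ i ∈ e
  | _, .ninp i, π => ∃ e : Set I, π 1 = π 0 ++ [e] ∧ i ∉ e
  | _, .next φ, π => Sat l φ (suffix π 1)
  | _, .untl φ ψ, π => ∃ m, Sat l ψ (suffix π m) ∧ ∀ j < m, Sat l φ (suffix π j)
  | _, .release φ ψ, π => (∀ m, Sat l ψ (suffix π m)) ∨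
      ∃ m, Sat l φ (suffix π m) ∧ ∀ j ≤ m, Sat l ψ (suffix π j)

/-- A state formula is realisable if the root of some computation tree satisfies it. -/
def Realisable (Φ : CTLStar I O .state) : Prop :=
  ∃ l : CompTree I (Set O), Sat l Φ []

open Classical in
/-- The finite set of those `φ` for which `E φ` is a subformula. -/
noncomputable def existSub : {s : Kind} → CTLStar I O s → Finset (CTLStar I O .path)
  | _, .tt => ∅
  | _, .ff => ∅
  | _, .out _ => ∅
  | _, .nout _ => ∅
  | _, .and φ ψ => existSub φ ∪ existSub ψ
  | _, .or φ ψ => existSub φ ∪ existSub ψ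
  | _, .all φ => existSub φ
  | _, .ex φ => insert φ (existSub φ)
  | _, .ofState Φ => existSub Φ
  | _, .inp _ => ∅
  | _, .ninp _ => ∅
  | _, .next φ => existSub φ
  | _, .untl φ ψ => existSub φ ∪ existSub ψ
  | _, .release φ ψ => existSub φ ∪ existSub ψ

open Classical in
/-- The finite set of those `φ` for which `A φ` is a subformula. -/
noncomputable def univSub : {s : Kind} → CTLStar I O s → Finset (CTLStar I O .path)
  | _, .tt => ∅
  | _, .ff => ∅
  | _, .out _ => ∅
  | _, .nout _ => ∅
  | _, .and φ ψ => univSub φ ∪ univSub ψ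
  | _, .or φ ψ => univSub φ ∪ univSub ψ
  | _, .all φ => insert φ (univSub φ)
  | _, .ex φ => univSub φ
  | _, .ofState Φ => univSub Φ
  | _, .inp _ => ∅
  | _, .ninp _ => ∅
  | _, .next φ => univSub φ
  | _, .untl φ ψ => univSub φ ∪ univSub ψ
  | _, .release φ ψ => univSub φ ∪ univSub ψ

/-- The quantified subformulas of a quantified subformula of `ψ` are among those of `ψ`. -/
theorem sub_of_mem_sub {s : Kind} (ψ : CTLStar I O s) :
    (∀ φ ∈ existSub ψ, existSub φ ⊆ existSub ψ ∧ univSub φ ⊆ univSub ψ) ∧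
    (∀ φ ∈ univSub ψ, existSub φ ⊆ existSub ψ ∧ univSub φ ⊆ univSub ψ) := by
  induction ψ <;>
    simp only [existSub, univSub, Finset.subset_iff, Finset.mem_union, Finset.mem_insert,
      Finset.notMem_empty] at * <;>
    grind

end CTLStar

/-! ### LTL -/

/-- LTL formulas over a set `P` of atomic propositions. -/
inductive LTL (P : Type u) : Type u
  | tt : LTL P
  | ff : LTL P
  | atom (p : P) : LTL P
  | neg (φ : LTL P) : LTL P
  | and (φ ψ : LTL P) : LTL P
  | next (φ : LTL P) : LTL P
  | untl (φ ψ : LTL P) : LTL P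

namespace LTL

variable {P : Type u}

/-- Satisfaction by an infinite word over the alphabet `2^P`. -/
def Sat : LTL P → (ℕ → Set P) → Prop
  | .tt, _ => True
  | .ff, _ => False
  | .atom p, σ => p ∈ σ 0
  | .neg φ, σ => ¬ Sat φ σ
  | .and φ ψ, σ => Sat φ σ ∧ Sat ψ σ
  | .next φ, σ => Sat φ (suffix σ 1)
  | .untl φ ψ, σ => ∃ m, Sat ψ (suffix σ m) ∧ ∀ j < m, Sat φ (suffix σ j)

def or (φ ψ : LTL P) : LTL P := neg (and (neg φ) (neg ψ))
def imp (φ ψ : LTL P) : LTL P := or (neg φ) ψ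
def iff (φ ψ : LTL P) : LTL P := and (imp φ ψ) (imp ψ φ)
def release (φ ψ : LTL P) : LTL P := neg (untl (neg φ) (neg ψ))
def eventually (φ : LTL P) : LTL P := untl tt φ
def always (φ : LTL P) : LTL P := neg (eventually (neg φ))

/-- The conjunction of a finite family of formulas (in an arbitrary order). -/
noncomputable def bigAnd {ι : Type w} [Fintype ι] (f : ι → LTL P) : LTL P :=
  (Finset.univ : Finset ι).toList.foldr (fun a φ => and (f a) φ) tt

end LTL

/-! ### LTL synthesis with Boolean inputs and finite-domain outputs -/

/-- Atomic propositions over Boolean inputs `I` and outputs `O`, where the output `o` takes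
values in `dom o`: an input, or an equation `o = c`. -/
inductive IOProp (I : Type u) (O : Type v) (dom : O → Type) : Type (max u v)
  | inp (i : I) : IOProp I O dom
  | outEq (o : O) (c : dom o) : IOProp I O dom

/-- The word of a tree path: at each position the label of the current node together with the
direction taken out of it. -/
def trace {I : Type u} {O : Type v} {dom : O → Type} (l : CompTree I (∀ o, dom o))
    (π : ℕ → Node I) : ℕ → Set (IOProp I O dom) :=
  fun m => {p | match p with
    | .inp i => ∃ e : Set I, π (m + 1) = π m ++ [e] ∧ i ∈ e
    | .outEq o c => l (π m) o = c}

/-- An LTL formula is realisable if there is a computation tree all of whose paths from the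
root satisfy it. -/
def LTL.Realisable {I : Type u} {O : Type v} {dom : O → Type} (φ : LTL (IOProp I O dom)) : Prop :=
  ∃ l : CompTree I (∀ o, dom o), ∀ π : ℕ → Node I, IsTreePath π → π 0 = [] → φ.Sat (trace l π)

/-! ### Nondeterministic Büchi word automata -/

/-- Nondeterministic Büchi word automata. Dead ends are allowed, so that automata with and
without rejecting sink states are covered. -/
structure NBW (α : Type u) (Q : Type w) where
  init : Q
  step : Q → α → Set Q
  final : Set Q

/-- Some run on the word visits some final state infinitely often. -/
def NBW.Accepts {α : Type u} {Q : Type w} (A : NBW α Q) (σ : ℕ → α) : Prop :=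
  ∃ ρ : ℕ → Q, ρ 0 = A.init ∧ (∀ m, ρ (m + 1) ∈ A.step (ρ m) (σ m)) ∧
    ∃ q ∈ A.final, ∃ᶠ m in Filter.atTop, ρ m = q

/-! ### The reduction -/

namespace CTLStar

variable {I : Type u} {O : Type v}

/-- Replace, in a CTL* formula, the maximal subformulas `A φ` by `fA φ` and `E φ` by `fE φ`,
an input `i` by `fi i` and an output `o` by `fo o`. -/
def replace {P : Type w} (fi : I → LTL P) (fo : O → LTL P)
    (fA fE : CTLStar I O .path → LTL P) : {s : Kind} → CTLStar I O s → LTL P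
  | _, .tt => .tt
  | _, .ff => .ff
  | _, .out o => fo o
  | _, .nout o => .neg (fo o)
  | _, .and φ ψ => .and (replace fi fo fA fE φ) (replace fi fo fA fE ψ)
  | _, .or φ ψ => .or (replace fi fo fA fE φ) (replace fi fo fA fE ψ)
  | _, .all φ => fA φ
  | _, .ex φ => fE φ
  | _, .ofState Φ => replace fi fo fA fE Φ
  | _, .inp i => fi i
  | _, .ninp i => .neg (fi i)
  | _, .next φ => .next (replace fi fo fA fE φ)
  | _, .untl φ ψ => .untl (replace fi fo fA fE φ) (replace fi fo fA fE ψ)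
  | _, .release φ ψ => .release (replace fi fo fA fE φ) (replace fi fo fA fE ψ)

/-- The propositions read by the word automata of `Φ`: inputs, outputs, and one proposition
for each quantified subformula of `Φ`. -/
inductive AutProp (Φ : CTLStar I O .state) : Type (max u v)
  | inp (i : I) : AutProp Φ
  | out (o : O) : AutProp Φ
  | univ (φ : {φ // φ ∈ univSub Φ}) : AutProp Φ
  | exist (φ : {φ // φ ∈ existSub Φ}) : AutProp Φ

open Classical in
/-- The LTL formula over `AutProp Φ` obtained from `ψ` by replacing its quantified subformulas
by their propositions. It is only used for subformulas `ψ` of `Φ`, whose quantified subformulas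
are among those of `Φ` (`sub_of_mem_sub`), so the `else` branches are never taken. -/
noncomputable def autFormula (Φ : CTLStar I O .state) {s : Kind} (ψ : CTLStar I O s) :
    LTL (AutProp Φ) :=
  replace (fun i => .atom (.inp i)) (fun o => .atom (.out o))
    (fun φ => if h : φ ∈ univSub Φ then .atom (.univ ⟨φ, h⟩) else .ff)
    (fun φ => if h : φ ∈ existSub Φ then .atom (.exist ⟨φ, h⟩) else .ff) ψ

/-- The outputs of the LTL specification: the original outputs `o`, the propositions `p_{A φ}`,
the numbered variables `v_{E φ}`, and, for each number `j`, one Boolean output for each input,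
which together hold a direction `d_j ∈ 2^I`. -/
inductive ExtOut (Φ : CTLStar I O .state) (k : ℕ) : Type (max u v)
  | orig (o : O) : ExtOut Φ k
  | univ (φ : {φ // φ ∈ univSub Φ}) : ExtOut Φ k
  | exist (φ : {φ // φ ∈ existSub Φ}) : ExtOut Φ k
  | dir (j : Fin k) (i : I) : ExtOut Φ k

/-- Everything is Boolean except the variables `v_{E φ}`, which range over `{0, ..., k}`. -/
abbrev ExtOut.dom {Φ : CTLStar I O .state} {k : ℕ} : ExtOut Φ k → Type
  | .orig _ => Bool
  | .univ _ => Bool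
  | .exist _ => Fin (k + 1)
  | .dir _ _ => Bool

/-- The propositions of the LTL specification. -/
abbrev ExtProp (Φ : CTLStar I O .state) (k : ℕ) : Type (max u v) :=
  IOProp I (ExtOut Φ k) ExtOut.dom

open Classical in
/-- The formula `ψ'` obtained from `ψ` by replacing `A φ` by `p_{A φ}` and `E φ` by
`v_{E φ} ≠ 0`. It is only used for subformulas `ψ` of `Φ`, so the `else` branches are never
taken. -/
noncomputable def prime (Φ : CTLStar I O .state) (k : ℕ) {s : Kind} (ψ : CTLStar I O s) :
    LTL (ExtProp Φ k) :=
  replace (fun i => .atom (.inp i)) (fun o => .atom (.outEq (.orig o) true))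
    (fun φ => if h : φ ∈ univSub Φ then .atom (.outEq (.univ ⟨φ, h⟩) true) else .ff)
    (fun φ => if h : φ ∈ existSub Φ then
      .neg (.atom (.outEq (.exist ⟨φ, h⟩) (0 : Fin (k + 1)))) else .ff) ψ

/-- The current input is the direction `d_j`. -/
noncomputable def followsDir [Fintype I] (Φ : CTLStar I O .state) (k : ℕ) (j : Fin k) :
    LTL (ExtProp Φ k) :=
  LTL.bigAnd fun i : I => .iff (.atom (.inp i)) (.atom (.outEq (.dir j i) true))

/-- `⋀_{j ∈ {1, ..., k}} G [v_{E φ} = j → (G d_j → φ')]`. The numbers `1, ..., k` are indexed by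
`j : Fin k` and are the values `j.succ` of `v_{E φ}`. -/
noncomputable def existClause [Fintype I] (Φ : CTLStar I O .state) (k : ℕ)
    (φ : {φ // φ ∈ existSub Φ}) : LTL (ExtProp Φ k) :=
  LTL.bigAnd fun j : Fin k =>
    .always (.imp (.atom (.outEq (.exist φ) j.succ))
      (.imp (.always (followsDir Φ k j)) (prime Φ k φ.1)))

/-- `G [p_{A φ} → φ']`. -/
noncomputable def univClause (Φ : CTLStar I O .state) (k : ℕ)
    (φ : {φ // φ ∈ univSub Φ}) : LTL (ExtProp Φ k) :=
  .always (.imp (.atom (.outEq (.univ φ) true)) (prime Φ k φ.1))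

/-- The LTL formula derived from `Φ` with `k` numbers. -/
noncomputable def toLTL [Fintype I] (Φ : CTLStar I O .state) (k : ℕ) : LTL (ExtProp Φ k) :=
  .and (prime Φ k Φ)
    (.and (LTL.bigAnd fun φ : {φ // φ ∈ existSub Φ} => existClause Φ k φ)
      (LTL.bigAnd fun φ : {φ // φ ∈ univSub Φ} => univClause Φ k φ))

end CTLStar

end CTLStarSynthesis

namespace CTLStarSynthesis

/-!
If the LTL formula is realised, a node with `v_{E φ} = j ≠ 0` satisfies `E φ`, the witness being
the path that takes direction `d_j` at each of its nodes.

Conversely, let a tree satisfy `Φ`. Its paths that witness some `E φ` at some node carry accepting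
runs of the automata, that is, they are plays with a Büchi objective in the product of the tree with
an automaton. Such objectives have positional strategies (always decrease the distance to the
objective), so the witnesses can be chosen such that a state of an automaton at a node determines
the rest of the path. The chosen paths are then closed under tails, and at most `k`, the total
number of states, start at each node. Hence they can be numbered, from the root downwards, such that
paths from the same node have different numbers and a tail has the number of the whole path. Let
`d_j` at a node be the direction of the path with number `j`: following `d_j` stays on that path.
-/

open Filter

/-! ### Sequences and tree paths -/

theorem suffix_zero {α : Type*} (σ : ℕ → α) : suffix σ 0 = σ := by
  funext j
  simp only [suffix, Nat.zero_add]

theorem suffix_suffix {α : Type*} (σ : ℕ → α) (m j : ℕ) :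
    suffix (suffix σ m) j = suffix σ (m + j) := by
  funext i
  simp only [suffix, Nat.add_assoc]

theorem eq_of_suffix_one_eq {α : Type*} {σ τ : ℕ → α} (h₀ : σ 0 = τ 0)
    (h : suffix σ 1 = suffix τ 1) : σ = τ := by
  funext m
  cases m with
  | zero => exact h₀
  | succ m => simpa only [suffix, Nat.add_comm 1] using congrFun h m

section TreePaths

variable {I : Type*} {π : ℕ → Node I}

protected theorem IsTreePath.suffix (h : IsTreePath π) (m : ℕ) : IsTreePath (suffix π m) :=
  fun j => h (m + j)

theorem IsTreePath.exists_eq_suffix_root (h : IsTreePath π) :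
    ∃ π' m, IsTreePath π' ∧ π' 0 = [] ∧ π = CTLStarSynthesis.suffix π' m := by
  induction hn : π 0 using List.reverseRecOn generalizing π with
  | nil => exact ⟨π, 0, h, hn, (suffix_zero π).symm⟩
  | append_singleton n e ih =>
    let π₁ : ℕ → Node I := fun m => Nat.casesOn m n π
    have hπ₁ : IsTreePath π₁ := fun m => Nat.casesOn m ⟨e, hn⟩ h
    obtain ⟨π', m, hπ', h₀, hm⟩ := ih hπ₁ rfl
    refine ⟨π', m + 1, hπ', h₀, ?_⟩
    calc π = CTLStarSynthesis.suffix π₁ 1 := by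
          funext j; simp only [CTLStarSynthesis.suffix, π₁, Nat.add_comm 1]
      _ = CTLStarSynthesis.suffix π' (m + 1) := by rw [hm, suffix_suffix]

/-- The path from `n` that takes the direction `D x` out of each node `x`: the memoryless
strategy given by a labelling of the nodes with directions. -/
def follow (D : Node I → Set I) (n : Node I) : ℕ → Node I
  | 0 => n
  | m + 1 => follow D n m ++ [D (follow D n m)]

theorem isTreePath_follow (D : Node I → Set I) (n : Node I) : IsTreePath (follow D n) :=
  fun _ => ⟨_, rfl⟩

theorem eq_follow_iff {D : Node I → Set I} :
    π = follow D (π 0) ↔ ∀ m, π (m + 1) = π m ++ [D (π m)] := by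
  constructor
  · intro h m
    rw [h]
    rfl
  · intro h
    funext m
    induction m with
    | zero => rfl
    | succ m ih => rw [h, follow, ← ih]

end TreePaths

/-! ### Positional strategies for Büchi objectives -/

section Buchi

variable {V : Type*} {R : V → V → Prop} {F : Set V} {ρ : ℕ → V}

theorem frequently_of_forall_or_lt {p : ℕ → Prop} {d : ℕ → ℕ}
    (h : ∀ m, p m ∨ d (m + 1) < d m) : ∃ᶠ m in atTop, p m := by
  refine frequently_atTop.2 fun N => ?_
  by_contra! hN
  obtain ⟨i, hi⟩ := WellFounded.not_rel_apply_succ (r := (· < ·)) fun i => d (N + i)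
  exact hi ((h (N + i)).resolve_left (hN _ (Nat.le_add_right N i)))

/-- `ρ` is an infinite path in the graph `R` that satisfies the Büchi objective `F`, that is,
visits `F` infinitely often. -/
def IsBuchiPath (R : V → V → Prop) (F : Set V) (ρ : ℕ → V) : Prop :=
  (∀ m, R (ρ m) (ρ (m + 1))) ∧ ∃ᶠ m in atTop, ρ m ∈ F

protected theorem IsBuchiPath.suffix (h : IsBuchiPath R F ρ) (m : ℕ) :
    IsBuchiPath R F (suffix ρ m) := by
  refine ⟨fun j => h.1 (m + j), ?_⟩
  have hF := h.2
  rw [← map_add_atTop_eq_nat m, frequently_map] at hF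
  simpa only [suffix, Nat.add_comm m] using hF

/-- The least number of steps in which some path with the Büchi objective `F` gets from `v`
to `F`; it is `0` (the infimum of `∅`) if there is no such path from `v`. -/
noncomputable def buchiDist (R : V → V → Prop) (F : Set V) (v : V) : ℕ :=
  sInf {d | ∃ ρ, IsBuchiPath R F ρ ∧ ρ 0 = v ∧ ρ d ∈ F}

theorem IsBuchiPath.exists_buchiDist_lt (h : IsBuchiPath R F ρ) :
    ∃ ρ', IsBuchiPath R F ρ' ∧ R (ρ 0) (ρ' 0) ∧
      (ρ 0 ∈ F ∨ buchiDist R F (ρ' 0) < buchiDist R F (ρ 0)) := by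
  have hne : {d | ∃ ρ', IsBuchiPath R F ρ' ∧ ρ' 0 = ρ 0 ∧ ρ' d ∈ F}.Nonempty :=
    h.2.exists.imp fun _ hd => ⟨ρ, h, rfl, hd⟩
  obtain ⟨ρ', hρ', h₀, hd⟩ := Nat.sInf_mem hne
  refine ⟨suffix ρ' 1, hρ'.suffix 1, h₀ ▸ hρ'.1 0, ?_⟩
  change ρ' (buchiDist R F (ρ 0)) ∈ F at hd
  cases hdist : buchiDist R F (ρ 0) with
  | zero => exact .inl (by rwa [hdist, h₀] at hd)
  | succ d =>
    refine .inr (Nat.lt_succ_of_le (Nat.sInf_le ⟨suffix ρ' 1, hρ'.suffix 1, rfl, ?_⟩))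
    rwa [hdist, Nat.add_comm] at hd

theorem exists_positional_isBuchiPath (R : V → V → Prop) (F : Set V) :
    ∃ f : V → V, ∀ ρ, IsBuchiPath R F ρ → IsBuchiPath R F fun m => f^[m] (ρ 0) := by
  let Wins (v : V) : Prop := ∃ ρ, IsBuchiPath R F ρ ∧ ρ 0 = v
  have hstep : ∀ v, ∃ v', Wins v →
      R v v' ∧ Wins v' ∧ (v ∈ F ∨ buchiDist R F v' < buchiDist R F v) := by
    intro v
    by_cases hv : Wins v
    · obtain ⟨ρ, hρ, rfl⟩ := hv
      obtain ⟨ρ', hρ', hR, hd⟩ := hρ.exists_buchiDist_lt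
      exact ⟨ρ' 0, fun _ => ⟨hR, ⟨ρ', hρ', rfl⟩, hd⟩⟩
    · exact ⟨v, fun h => absurd h hv⟩
  choose f hf using hstep
  refine ⟨f, fun ρ hρ => ?_⟩
  have hwins : ∀ m, Wins (f^[m] (ρ 0)) := by
    intro m
    induction m with
    | zero => exact ⟨ρ, hρ, rfl⟩
    | succ m ih =>
      rw [Function.iterate_succ_apply']
      exact (hf _ ih).2.1
  refine ⟨fun m => ?_, frequently_of_forall_or_lt (d := fun m => buchiDist R F (f^[m] (ρ 0)))
    fun m => ?_⟩
  · simp only [Function.iterate_succ_apply']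
    exact (hf _ (hwins m)).1
  · simp only [Function.iterate_succ_apply']
    exact (hf _ (hwins m)).2.2

end Buchi

/-! ### Numbering the paths of a tree -/

section Numbering

theorem exists_dependent_labelling {α : Type*} {X : List α → Type*}
    {S : ∀ n e, X n → X (n ++ [e]) → Prop} (x₀ : X []) (hS : ∀ n e x, ∃ y, S n e x y) :
    ∃ F : ∀ n, X n, ∀ n e, S n e (F n) (F (n ++ [e])) := by
  choose next hnext using hS
  refine ⟨List.reverseRec x₀ next, fun n e => ?_⟩
  simp only [List.reverseRec_concat]
  exact hnext n e _

theorem exists_embedding_extending {α β γ : Type*} [Finite β] (h : Nonempty (α ↪ β))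
    (i : γ ↪ α) (g : γ ↪ β) : ∃ g' : α ↪ β, ∀ x, g' (i x) = g x := by
  classical
  obtain ⟨h⟩ := h
  have := Fintype.ofFinite β
  let e : Set.range (i.trans h) ≃ Set.range g :=
    (Equiv.ofInjective _ (i.trans h).injective).symm.trans (Equiv.ofInjective _ g.injective)
  refine ⟨h.trans e.extendSubtype.toEmbedding, fun x => ?_⟩
  have he : e ⟨h (i x), x, rfl⟩ = ⟨g x, x, rfl⟩ := by
    have hi : (Equiv.ofInjective _ (i.trans h).injective).symm ⟨h (i x), x, rfl⟩ = x :=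
      Equiv.ofInjective_symm_apply (i.trans h).injective x
    exact congrArg (Equiv.ofInjective _ g.injective) hi
  exact (e.extendSubtype_apply_of_mem _ ⟨x, rfl⟩).trans (congrArg Subtype.val he)

variable {I β : Type*} [Finite β] {T : Set (ℕ → Node I)}

theorem exists_numbering (hpath : ∀ π ∈ T, IsTreePath π) (htail : ∀ π ∈ T, suffix π 1 ∈ T)
    (hcard : ∀ n, Nonempty ({π : T // π.1 0 = n} ↪ β)) :
    ∃ num : T → β, (∀ π π' : T, π.1 0 = π'.1 0 → num π = num π' → π = π') ∧
      ∀ π : T, num ⟨suffix π 1, htail π π.2⟩ = num π := by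
  have hstep : ∀ n e (c : {π : T // π.1 0 = n} ↪ β), ∃ c' : {π : T // π.1 0 = n ++ [e]} ↪ β,
      ∀ (π : T) (h₀ : π.1 0 = n) (h₁ : π.1 1 = n ++ [e]),
        c' ⟨⟨suffix π 1, htail π π.2⟩, h₁⟩ = c ⟨π, h₀⟩ := by
    intro n e c
    let tail : {π : {π : T // π.1 0 = n} // π.1.1 1 = n ++ [e]} ↪ {π : T // π.1 0 = n ++ [e]} :=
      ⟨fun π => ⟨⟨suffix π.1.1 1, htail _ π.1.1.2⟩, π.2⟩, fun π π' h =>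
        Subtype.ext <| Subtype.ext <| Subtype.ext <| eq_of_suffix_one_eq
          (π.1.2.trans π'.1.2.symm) (congrArg (·.1.1) h)⟩
    obtain ⟨c', hc'⟩ := exists_embedding_extending (hcard (n ++ [e])) tail
      ((Function.Embedding.subtype _).trans c)
    exact ⟨c', fun π h₀ h₁ => hc' ⟨⟨π, h₀⟩, h₁⟩⟩
  obtain ⟨col, hcol⟩ := exists_dependent_labelling (hcard []).some hstep
  refine ⟨fun π => col (π.1 0) ⟨π, rfl⟩, fun π π' h₀ h => ?_, fun π => ?_⟩
  · have hcongr : ∀ n (hn : π'.1 0 = n), col n ⟨π', hn⟩ = col (π'.1 0) ⟨π', rfl⟩ := by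
      rintro _ rfl
      rfl
    exact congrArg Subtype.val ((col _).injective (h.trans (hcongr _ h₀.symm).symm))
  · obtain ⟨e, he⟩ := hpath π π.2 0
    have hcongr : ∀ n (hn : π.1 1 = n), col (π.1 1) ⟨⟨suffix π.1 1, htail π π.2⟩, rfl⟩ =
        col n ⟨⟨suffix π.1 1, htail π π.2⟩, hn⟩ := by
      rintro _ rfl
      rfl
    exact (hcongr _ he).trans (hcol _ e π rfl he)

theorem exists_directions (hpath : ∀ π ∈ T, IsTreePath π) (htail : ∀ π ∈ T, suffix π 1 ∈ T)
    (hcard : ∀ n, Nonempty ({π : T // π.1 0 = n} ↪ β)) :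
    ∃ D : Node I → β → Set I, ∀ π ∈ T, ∃ j, π = follow (fun n => D n j) (π 0) := by
  obtain ⟨num, hinj, hnum⟩ := exists_numbering hpath htail hcard
  let D (n : Node I) (j : β) : Set I :=
    {i | ∃ π : T, π.1 0 = n ∧ num π = j ∧ ∃ e, π.1 1 = n ++ [e] ∧ i ∈ e}
  have hD : ∀ π : T, π.1 1 = π.1 0 ++ [D (π.1 0) (num π)] := by
    intro π
    obtain ⟨e, he⟩ := hpath π π.2 0
    suffices D (π.1 0) (num π) = e by rw [this, he]
    ext i
    constructor
    · rintro ⟨π', h₀, h, e', he', hi⟩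
      obtain rfl := hinj π' π h₀ h
      simp_all
    · exact fun hi => ⟨π, rfl, rfl, e, he, hi⟩
  have hsuffix : ∀ (π : T) m, ∃ π' : T, π'.1 = suffix π m ∧ num π' = num π := by
    intro π m
    induction m with
    | zero => exact ⟨π, (suffix_zero π.1).symm, rfl⟩
    | succ m ih =>
      obtain ⟨π', hπ', h⟩ := ih
      exact ⟨⟨suffix π' 1, htail π' π'.2⟩, by simp only [hπ', suffix_suffix], (hnum π').trans h⟩
  refine ⟨D, fun π hπ => ⟨num ⟨π, hπ⟩, eq_follow_iff.2 fun m => ?_⟩⟩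
  obtain ⟨π', hπ', h⟩ := hsuffix ⟨π, hπ⟩ m
  simpa only [h, hπ', suffix, Nat.add_zero] using hD π'

end Numbering
/-! ### Automata on the paths of a tree -/

section Automata

/-- The word read along the sequence of nodes `π` in a graph whose edge from `x` to `y` carries
the letter `lab x y`. -/
def edgeWord {N β : Type*} (lab : N → N → β) (π : ℕ → N) : ℕ → β :=
  fun m => lab (π m) (π (m + 1))

/-- The edge relation of the product of a Büchi automaton with an edge-labelled graph. -/
def NBW.productStep {N β Q : Type*} (A : NBW β Q) (E : N → N → Prop) (lab : N → N → β)
    (c c' : N × Q) : Prop :=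
  E c.1 c'.1 ∧ c'.2 ∈ A.step c.2 (lab c.1 c'.1)

theorem NBW.accepts_edgeWord_iff {N β Q : Type*} [Finite Q] {A : NBW β Q} {E : N → N → Prop}
    {lab : N → N → β} {π : ℕ → N} (hπ : ∀ m, E (π m) (π (m + 1))) :
    A.Accepts (edgeWord lab π) ↔ ∃ ρ : ℕ → Q, ρ 0 = A.init ∧
      IsBuchiPath (A.productStep E lab) (Prod.snd ⁻¹' A.final) fun m => (π m, ρ m) := by
  have hfinal : ∀ ρ : ℕ → Q,
      (∃ᶠ m in atTop, ρ m ∈ A.final) ↔ ∃ q ∈ A.final, ∃ᶠ m in atTop, ρ m = q := fun ρ => by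
    rw [← A.final.toFinite.frequently_exists]
    simp only [exists_eq_right']
  simp only [Accepts, IsBuchiPath, productStep, hπ, true_and, Set.mem_preimage, hfinal, edgeWord]

/-- The edge relation of the tree with directions `2^I`. -/
def IsChild {I : Type*} (n n' : Node I) : Prop :=
  ∃ e : Set I, n' = n ++ [e]

variable {I β ι : Type*} {Q : ι → Type*}

-- Following positional strategies in the product of each automaton with the tree, the rest of a
-- witness depends only on the current node, automaton and state.
theorem exists_tail_closed_witnesses [∀ i, Finite (Q i)] (A : ∀ i, NBW β (Q i))
    (lab : Node I → Node I → β) :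
    ∃ T : Set (ℕ → Node I), (∀ π ∈ T, IsTreePath π) ∧ (∀ π ∈ T, suffix π 1 ∈ T) ∧
      (∀ n, Nonempty ({π : T // π.1 0 = n} ↪ Σ i, Q i)) ∧
      ∀ i π, IsTreePath π → (A i).Accepts (edgeWord lab π) →
        ∃ π' ∈ T, π' 0 = π 0 ∧ (A i).Accepts (edgeWord lab π') := by
  let IsRun (i : ι) : (ℕ → Node I × Q i) → Prop :=
    IsBuchiPath ((A i).productStep IsChild lab) (Prod.snd ⁻¹' (A i).final)
  choose f hf using fun i =>
    exists_positional_isBuchiPath ((A i).productStep IsChild lab) (Prod.snd ⁻¹' (A i).final)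
  let play (i : ι) (c : Node I × Q i) (m : ℕ) : Node I := ((f i)^[m] c).1
  refine ⟨{π | ∃ i ρ, IsRun i ρ ∧ π = play i (ρ 0)}, ?_, ?_, fun n => ?_, ?_⟩
  · rintro _ ⟨i, ρ, hρ, rfl⟩ m
    exact ((hf i ρ hρ).1 m).1
  · rintro _ ⟨i, ρ, hρ, rfl⟩
    refine ⟨i, _, (hf i ρ hρ).suffix 1, funext fun m => ?_⟩
    simp only [suffix, play, Nat.add_comm 1 m, Function.iterate_succ_apply,
      Function.iterate_zero, id_eq]
  · have hstate : ∀ π : {π : {π | ∃ i ρ, IsRun i ρ ∧ π = play i (ρ 0)} // π.1 0 = n},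
        ∃ x : Σ i, Q i, π.1.1 = play x.1 (n, x.2) := by
      rintro ⟨⟨_, i, ρ, -, rfl⟩, rfl⟩
      exact ⟨⟨i, (ρ 0).2⟩, rfl⟩
    choose state hstate using hstate
    exact ⟨state, fun π π' h => Subtype.ext <| Subtype.ext <| by rw [hstate, hstate, h]⟩
  · intro i π hπ hacc
    obtain ⟨ρ, h₀, hρ⟩ := (NBW.accepts_edgeWord_iff (E := IsChild) hπ).1 hacc
    have hplay := hf i _ hρ
    refine ⟨_, ⟨i, _, hρ, rfl⟩, rfl, (NBW.accepts_edgeWord_iff (E := IsChild) ?_).2 ?_⟩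
    · exact fun m => (hplay.1 m).1
    · exact ⟨fun m => ((f i)^[m] (π 0, ρ 0)).2, h₀, hplay⟩

theorem exists_accepted_directions [Fintype ι] [∀ i, Fintype (Q i)] (A : ∀ i, NBW β (Q i))
    (lab : Node I → Node I → β) {k : ℕ} (hk : ∑ i, Fintype.card (Q i) ≤ k) :
    ∃ D : Node I → Fin k → Set I, ∀ i π, IsTreePath π → (A i).Accepts (edgeWord lab π) →
      ∃ j, (A i).Accepts (edgeWord lab (follow (fun n => D n j) (π 0))) := by
  obtain ⟨T, hpath, htail, hcard, hT⟩ := exists_tail_closed_witnesses A lab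
  obtain ⟨enum⟩ : Nonempty ((Σ i, Q i) ↪ Fin k) :=
    Function.Embedding.nonempty_of_card_le (by rwa [Fintype.card_sigma, Fintype.card_fin])
  obtain ⟨D, hD⟩ := exists_directions hpath htail fun n => (hcard n).map fun c => c.trans enum
  refine ⟨D, fun i π hπ hacc => ?_⟩
  obtain ⟨π', hπ', h₀, hacc'⟩ := hT i π hπ hacc
  obtain ⟨j, hj⟩ := hD π' hπ'
  exact ⟨j, by rwa [← h₀, ← hj]⟩

end Automata

/-! ### Semantics of the derived operators -/

namespace LTL

variable {P : Type*} {σ : ℕ → Set P} {φ ψ : LTL P}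

theorem sat_or : (or φ ψ).Sat σ ↔ φ.Sat σ ∨ ψ.Sat σ := by
  simp only [or, Sat]
  tauto

theorem sat_imp : (imp φ ψ).Sat σ ↔ (φ.Sat σ → ψ.Sat σ) := by
  simp only [imp, sat_or, Sat]
  tauto

theorem sat_iff : (iff φ ψ).Sat σ ↔ (φ.Sat σ ↔ ψ.Sat σ) := by
  simp only [iff, sat_imp, Sat]
  tauto

theorem sat_always : (always φ).Sat σ ↔ ∀ m, φ.Sat (suffix σ m) := by
  simp [always, eventually, Sat]

theorem sat_release : (release φ ψ).Sat σ ↔ (∀ m, ψ.Sat (suffix σ m)) ∨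
    ∃ m, φ.Sat (suffix σ m) ∧ ∀ j ≤ m, ψ.Sat (suffix σ j) := by
  classical
  simp only [release, Sat, not_exists, not_and, not_forall, not_not, exists_prop]
  constructor
  · intro h
    by_cases hψ : ∃ m, ¬ ψ.Sat (suffix σ m)
    · obtain ⟨j, hj, hφ⟩ := h (Nat.find hψ) (Nat.find_spec hψ)
      exact .inr ⟨j, hφ, fun i hi => not_not.1 (Nat.find_min hψ (hi.trans_lt hj))⟩
    · exact .inl (not_exists_not.1 hψ)
  · rintro (h | ⟨m, hφ, hψ⟩) j hj
    · exact absurd (h j) hj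
    · exact ⟨m, lt_of_not_ge fun hjm => hj (hψ j hjm), hφ⟩

theorem sat_bigAnd {ι : Type*} [Fintype ι] {f : ι → LTL P} :
    (bigAnd f).Sat σ ↔ ∀ a, (f a).Sat σ := by
  have hfoldr : ∀ L : List ι,
      (L.foldr (fun a φ => and (f a) φ) tt).Sat σ ↔ ∀ a ∈ L, (f a).Sat σ := by
    intro L
    induction L with
    | nil => simp [Sat]
    | cons a L ih => simp [Sat, ih]
  simp [bigAnd, hfoldr]

end LTL

/-! ### Semantics of the replacement of quantified subformulas -/

namespace CTLStar

variable {I O : Type*}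

/-- The point at which a formula of a given kind is evaluated along a sequence of nodes: state
formulas are evaluated at its first node. -/
def pointOf (π : ℕ → Node I) : (s : Kind) → Point I s
  | .state => π 0
  | .path => π

theorem sat_ninp_iff {l : CompTree I (Set O)} {π : ℕ → Node I} (hπ : IsTreePath π) {i : I} :
    Sat l (.ninp i) π ↔ ¬ Sat l (.inp i) π := by
  obtain ⟨e, he⟩ := hπ 0
  rw [Nat.zero_add] at he
  simp [Sat, he]

section Replace

variable {P : Type*} {l : CompTree I (Set O)} {fi : I → LTL P} {fo : O → LTL P}
  {fA fE : CTLStar I O .path → LTL P} {w : (ℕ → Node I) → ℕ → Set P}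

/-- The words `w π` encode the sequences of nodes `π` of the tree `l`, with `fi` and `fo`
expressing the inputs and the outputs. -/
structure IsEncoding (l : CompTree I (Set O)) (fi : I → LTL P) (fo : O → LTL P)
    (w : (ℕ → Node I) → ℕ → Set P) : Prop where
  suffix_eq : ∀ π m, suffix (w π) m = w (suffix π m)
  sat_inp : ∀ i π, (fi i).Sat (w π) ↔ Sat l (.inp i) π
  sat_out : ∀ o π, (fo o).Sat (w π) ↔ Sat l (.out o) (π 0)

theorem IsEncoding.sat_replace_iff (hw : IsEncoding l fi fo w) {s : Kind} (ψ : CTLStar I O s)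
    (hA : ∀ φ ∈ univSub ψ, ∀ π, IsTreePath π →
      ((fA φ).Sat (w π) ↔ Sat l (.all φ) (π 0)))
    (hE : ∀ φ ∈ existSub ψ, ∀ π, IsTreePath π →
      ((fE φ).Sat (w π) ↔ Sat l (.ex φ) (π 0)))
    (π : ℕ → Node I) (hπ : IsTreePath π) :
    (replace fi fo fA fE ψ).Sat (w π) ↔ Sat l ψ (pointOf π s) := by
  induction ψ generalizing π with
  | tt => rfl
  | ff => rfl
  | out o => exact hw.sat_out o π
  | nout o => exact not_congr (hw.sat_out o π)
  | and φ ψ ih₁ ih₂ =>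
    simp only [univSub, existSub, Finset.mem_union, or_imp, forall_and] at hA hE
    exact and_congr (ih₁ hA.1 hE.1 π hπ) (ih₂ hA.2 hE.2 π hπ)
  | or φ ψ ih₁ ih₂ =>
    simp only [univSub, existSub, Finset.mem_union, or_imp, forall_and] at hA hE
    exact LTL.sat_or.trans (or_congr (ih₁ hA.1 hE.1 π hπ) (ih₂ hA.2 hE.2 π hπ))
  | all φ => exact hA φ (by simp only [univSub, Finset.mem_insert_self]) π hπ
  | ex φ => exact hE φ (by simp only [existSub, Finset.mem_insert_self]) π hπ
  | ofState Ψ ih => exact ih hA hE π hπ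
  | inp i => exact hw.sat_inp i π
  | ninp i => exact (not_congr (hw.sat_inp i π)).trans (sat_ninp_iff hπ).symm
  | next φ ih =>
    simp only [replace, LTL.Sat, hw.suffix_eq]
    exact ih hA hE _ (hπ.suffix 1)
  | untl φ ψ ih₁ ih₂ =>
    simp only [univSub, existSub, Finset.mem_union, or_imp, forall_and] at hA hE
    have h₁ := fun m => ih₁ hA.1 hE.1 _ (hπ.suffix m)
    have h₂ := fun m => ih₂ hA.2 hE.2 _ (hπ.suffix m)
    simp only [replace, LTL.Sat, hw.suffix_eq, h₁, h₂]
    rfl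
  | release φ ψ ih₁ ih₂ =>
    simp only [univSub, existSub, Finset.mem_union, or_imp, forall_and] at hA hE
    have h₁ := fun m => ih₁ hA.1 hE.1 _ (hπ.suffix m)
    have h₂ := fun m => ih₂ hA.2 hE.2 _ (hπ.suffix m)
    simp only [replace, LTL.sat_release, hw.suffix_eq, h₁, h₂]
    rfl

-- One-sided, since replaced quantifiers occur only positively.
theorem IsEncoding.sat_of_sat_replace (hw : IsEncoding l fi fo w) {s : Kind}
    (ψ : CTLStar I O s)
    (hA : ∀ φ ∈ univSub ψ,
      (∀ π, IsTreePath π → (replace fi fo fA fE φ).Sat (w π) → Sat l φ π) →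
      ∀ π, IsTreePath π → (fA φ).Sat (w π) → Sat l (.all φ) (π 0))
    (hE : ∀ φ ∈ existSub ψ,
      (∀ π, IsTreePath π → (replace fi fo fA fE φ).Sat (w π) → Sat l φ π) →
      ∀ π, IsTreePath π → (fE φ).Sat (w π) → Sat l (.ex φ) (π 0))
    (π : ℕ → Node I) (hπ : IsTreePath π) (h : (replace fi fo fA fE ψ).Sat (w π)) :
    Sat l ψ (pointOf π s) := by
  induction ψ generalizing π with
  | tt => trivial
  | ff => exact h
  | out o => exact (hw.sat_out o π).1 h
  | nout o => exact mt (hw.sat_out o π).2 h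
  | and φ ψ ih₁ ih₂ =>
    simp only [univSub, existSub, Finset.mem_union, or_imp, forall_and] at hA hE
    exact ⟨ih₁ hA.1 hE.1 π hπ h.1, ih₂ hA.2 hE.2 π hπ h.2⟩
  | or φ ψ ih₁ ih₂ =>
    simp only [univSub, existSub, Finset.mem_union, or_imp, forall_and] at hA hE
    exact (LTL.sat_or.1 h).imp (ih₁ hA.1 hE.1 π hπ) (ih₂ hA.2 hE.2 π hπ)
  | all φ ih =>
    simp only [univSub, existSub, Finset.forall_mem_insert] at hA hE
    exact hA.1 (ih hA.2 hE) π hπ h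
  | ex φ ih =>
    simp only [univSub, existSub, Finset.forall_mem_insert] at hA hE
    exact hE.1 (ih hA hE.2) π hπ h
  | ofState Ψ ih => exact ih hA hE π hπ h
  | inp i => exact (hw.sat_inp i π).1 h
  | ninp i => exact (sat_ninp_iff hπ).2 (mt (hw.sat_inp i π).2 h)
  | next φ ih =>
    simp only [replace, LTL.Sat, hw.suffix_eq] at h
    exact ih hA hE _ (hπ.suffix 1) h
  | untl φ ψ ih₁ ih₂ =>
    simp only [univSub, existSub, Finset.mem_union, or_imp, forall_and] at hA hE
    simp only [replace, LTL.Sat, hw.suffix_eq] at h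
    obtain ⟨m, hm, hlt⟩ := h
    exact ⟨m, ih₂ hA.2 hE.2 _ (hπ.suffix m) hm,
      fun j hj => ih₁ hA.1 hE.1 _ (hπ.suffix j) (hlt j hj)⟩
  | release φ ψ ih₁ ih₂ =>
    simp only [univSub, existSub, Finset.mem_union, or_imp, forall_and] at hA hE
    simp only [replace, LTL.sat_release, hw.suffix_eq] at h
    have h₂ := fun m => ih₂ hA.2 hE.2 _ (hπ.suffix m)
    exact h.imp (fun h m => h₂ m (h m)) fun ⟨m, hm, hle⟩ =>
      ⟨m, ih₁ hA.1 hE.1 _ (hπ.suffix m) hm, fun j hj => h₂ j (hle j hj)⟩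

end Replace

/-! ### From the LTL specification to CTL* -/

section Soundness

variable {Φ : CTLStar I O .state} {k : ℕ} {l : CompTree I (∀ o : ExtOut Φ k, o.dom)}
  {π : ℕ → Node I}

/-- The original outputs of a tree labelled with the extended outputs. -/
def origTree (l : CompTree I (∀ o : ExtOut Φ k, o.dom)) : CompTree I (Set O) :=
  fun n => {o | l n (.orig o) = true}

/-- The direction `d_j` that a tree labelled with the extended outputs holds at a node. -/
def storedDir (l : CompTree I (∀ o : ExtOut Φ k, o.dom)) (j : Fin k) (n : Node I) : Set I :=
  {i | l n (.dir j i) = true}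

theorem isEncoding_trace (l : CompTree I (∀ o : ExtOut Φ k, o.dom)) :
    IsEncoding (origTree l) (fun i => .atom (.inp i))
      (fun o => .atom (.outEq (.orig o) true)) (trace l) where
  suffix_eq _ _ := rfl
  sat_inp _ _ := Iff.rfl
  sat_out _ _ := Iff.rfl

theorem forall_sat_always_trace_iff {χ : LTL (ExtProp Φ k)} :
    (∀ π, IsTreePath π → π 0 = [] → χ.always.Sat (trace l π)) ↔
      ∀ π, IsTreePath π → χ.Sat (trace l π) := by
  simp only [LTL.sat_always]
  refine ⟨fun h π hπ => ?_, fun h π hπ _ m => h _ (hπ.suffix m)⟩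
  obtain ⟨π', m, hπ', h₀, rfl⟩ := hπ.exists_eq_suffix_root
  exact h π' hπ' h₀ m

theorem sat_followsDir [Fintype I] {j : Fin k} (hπ : IsTreePath π) :
    (followsDir Φ k j).Sat (trace l π) ↔ π 1 = π 0 ++ [storedDir l j (π 0)] := by
  obtain ⟨e, he⟩ := hπ 0
  have hinp : ∀ i, .inp i ∈ trace l π 0 ↔ i ∈ e := fun i => by simp [trace, he]
  have hdir : ∀ i, .outEq (.dir j i) true ∈ trace l π 0 ↔ i ∈ storedDir l j (π 0) :=
    fun i => Iff.rfl
  simp only [followsDir, LTL.sat_bigAnd, LTL.sat_iff, LTL.Sat, hinp, hdir]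
  rw [Nat.zero_add] at he
  rw [← Set.ext_iff, he, List.append_right_inj, List.singleton_inj]

theorem sat_always_followsDir [Fintype I] {j : Fin k} (hπ : IsTreePath π) :
    (followsDir Φ k j).always.Sat (trace l π) ↔ π = follow (storedDir l j) (π 0) := by
  rw [LTL.sat_always, eq_follow_iff]
  exact forall_congr' fun m => sat_followsDir (hπ.suffix m)

theorem forall_sat_existClause_iff [Fintype I] {φ : {φ // φ ∈ existSub Φ}} :
    (∀ π, IsTreePath π → π 0 = [] → (existClause Φ k φ).Sat (trace l π)) ↔
      ∀ (j : Fin k) n, l n (.exist φ) = j.succ →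
        (prime Φ k φ.1).Sat (trace l (follow (storedDir l j) n)) := by
  simp only [existClause, LTL.sat_bigAnd, forall_comm (β := Fin k),
    forall_sat_always_trace_iff, LTL.sat_imp]
  constructor
  · intro h j n hj
    have hfollow := isTreePath_follow (storedDir l j) n
    exact h j _ hfollow hj ((sat_always_followsDir hfollow).2 rfl)
  · intro h j π hπ hj hdir
    rw [(sat_always_followsDir hπ).1 hdir]
    exact h j _ hj

theorem forall_sat_univClause_iff {φ : {φ // φ ∈ univSub Φ}} :
    (∀ π, IsTreePath π → π 0 = [] → (univClause Φ k φ).Sat (trace l π)) ↔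
      ∀ π, IsTreePath π → l (π 0) (.univ φ) = true → (prime Φ k φ.1).Sat (trace l π) := by
  simp only [univClause, forall_sat_always_trace_iff, LTL.sat_imp]
  rfl

theorem realisable_toLTL_iff [Fintype I] :
    (toLTL Φ k).Realisable ↔ ∃ l : CompTree I (∀ o : ExtOut Φ k, o.dom),
      (∀ π, IsTreePath π → π 0 = [] → (prime Φ k Φ).Sat (trace l π)) ∧
      (∀ φ (j : Fin k) n, l n (.exist φ) = j.succ →
        (prime Φ k φ.1).Sat (trace l (follow (storedDir l j) n))) ∧
      ∀ φ π, IsTreePath π → l (π 0) (.univ φ) = true → (prime Φ k φ.1).Sat (trace l π) := by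
  simp only [← forall_sat_existClause_iff, ← forall_sat_univClause_iff]
  simp only [LTL.Realisable, toLTL, LTL.Sat, LTL.sat_bigAnd, imp_and, forall_and,
    forall_comm (α := {φ // φ ∈ _})]

theorem sat_origTree_of_sat_prime
    (hE : ∀ φ (j : Fin k) n, l n (.exist φ) = j.succ →
      (prime Φ k φ.1).Sat (trace l (follow (storedDir l j) n)))
    (hA : ∀ φ π, IsTreePath π → l (π 0) (.univ φ) = true → (prime Φ k φ.1).Sat (trace l π))
    (hπ : IsTreePath π) (h : (prime Φ k Φ).Sat (trace l π)) :
    Sat (origTree l) Φ (π 0) := by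
  refine (isEncoding_trace l).sat_of_sat_replace Φ ?_ ?_ π hπ h
  · intro φ hφ ih π _ hp π' hπ' h₀
    rw [dif_pos hφ] at hp
    exact ih π' hπ' (hA ⟨φ, hφ⟩ π' hπ' (by rw [h₀]; exact hp))
  · intro φ hφ ih π _ hv
    rw [dif_pos hφ] at hv
    obtain ⟨j, hj⟩ : ∃ j : Fin k, j.succ = l (π 0) (.exist ⟨φ, hφ⟩) := Fin.exists_succ_eq.2 hv
    have hfollow := isTreePath_follow (storedDir l j) (π 0)
    exact ⟨_, hfollow, rfl, ih _ hfollow (hE ⟨φ, hφ⟩ j (π 0) hj.symm)⟩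

theorem realisable_of_realisable_toLTL [Fintype I] (h : (toLTL Φ k).Realisable) :
    Φ.Realisable := by
  obtain ⟨l, hΦ, hE, hA⟩ := realisable_toLTL_iff.1 h
  have hfollow := isTreePath_follow (fun _ : Node I => (∅ : Set I)) []
  exact ⟨origTree l, sat_origTree_of_sat_prime hE hA hfollow (hΦ _ hfollow rfl)⟩

end Soundness

/-! ### From CTL* to the LTL specification -/

section Completeness

variable {Φ : CTLStar I O .state} {k : ℕ} {l : CompTree I (Set O)} {D : Node I → Fin k → Set I}

/-- The letter read by the word automata on the edge from `n` to its child `n'`, where quantified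
subformulas are given their truth values at `n`. -/
def autLetter (Φ : CTLStar I O .state) (l : CompTree I (Set O)) (n n' : Node I) :
    Set Φ.AutProp :=
  {p | match p with
    | .inp i => ∃ e : Set I, n' = n ++ [e] ∧ i ∈ e
    | .out o => o ∈ l n
    | .univ φ => Sat l (.all φ.1) n
    | .exist φ => Sat l (.ex φ.1) n}

theorem isEncoding_edgeWord_autLetter (Φ : CTLStar I O .state) (l : CompTree I (Set O)) :
    IsEncoding l (fun i => .atom (.inp i)) (fun o => .atom (.out o))
      (edgeWord (autLetter Φ l)) where
  suffix_eq _ _ := rfl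
  sat_inp _ _ := Iff.rfl
  sat_out _ _ := Iff.rfl

theorem sat_autFormula_iff {s : Kind} {ψ : CTLStar I O s} (h₁ : existSub ψ ⊆ existSub Φ)
    (h₂ : univSub ψ ⊆ univSub Φ) {π : ℕ → Node I} (hπ : IsTreePath π) :
    (autFormula Φ ψ).Sat (edgeWord (autLetter Φ l) π) ↔ Sat l ψ (pointOf π s) := by
  refine (isEncoding_edgeWord_autLetter Φ l).sat_replace_iff ψ
    (fun φ hφ π _ => ?_) (fun φ hφ π _ => ?_) π hπ
  · rw [dif_pos (h₂ hφ)]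
    rfl
  · rw [dif_pos (h₁ hφ)]
    rfl

/-- At every node, each existential subformula of `Φ` that holds has one of the paths that
follow a labelling `D · j` as a witness. -/
def HasWitnessDirections (Φ : CTLStar I O .state) (l : CompTree I (Set O))
    (D : Node I → Fin k → Set I) : Prop :=
  ∀ φ ∈ existSub Φ, ∀ n, Sat l (.ex φ) n → ∃ j, Sat l φ (follow (fun x => D x j) n)

theorem exists_hasWitnessDirections {Q : {φ // φ ∈ Φ.existSub} → Type*} [∀ φ, Fintype (Q φ)]
    (A : ∀ φ : {φ // φ ∈ Φ.existSub}, NBW (Set Φ.AutProp) (Q φ))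
    (hA : ∀ (φ : {φ // φ ∈ Φ.existSub}) (σ : ℕ → Set Φ.AutProp),
      (A φ).Accepts σ ↔ (Φ.autFormula φ.1).Sat σ)
    (hk : ∑ φ, Fintype.card (Q φ) ≤ k) (l : CompTree I (Set O)) :
    ∃ D : Node I → Fin k → Set I, HasWitnessDirections Φ l D := by
  have hacc : ∀ (φ : {φ // φ ∈ Φ.existSub}) π, IsTreePath π →
      ((A φ).Accepts (edgeWord (autLetter Φ l) π) ↔ Sat l φ.1 π) := fun φ π hπ => by
    obtain ⟨h₁, h₂⟩ := (sub_of_mem_sub Φ).1 φ.1 φ.2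
    rw [hA]
    exact sat_autFormula_iff h₁ h₂ hπ
  obtain ⟨D, hD⟩ := exists_accepted_directions A (autLetter Φ l) hk
  refine ⟨D, fun φ hφ n => ?_⟩
  rintro ⟨π, hπ, rfl, hsat⟩
  obtain ⟨j, hj⟩ := hD ⟨φ, hφ⟩ π hπ ((hacc ⟨φ, hφ⟩ π hπ).2 hsat)
  exact ⟨j, (hacc ⟨φ, hφ⟩ _ (isTreePath_follow _ _)).1 hj⟩

open Classical in
/-- The value of `v_{E φ}` at the node `n`: the number of a direction labelling that leads along
a path satisfying `φ`, or `0` if there is none. -/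
noncomputable def witnessNum (l : CompTree I (Set O)) (D : Node I → Fin k → Set I)
    (φ : CTLStar I O .path) (n : Node I) : Fin (k + 1) :=
  if h : ∃ j, Sat l φ (follow (fun x => D x j) n) then h.choose.succ else 0

theorem sat_follow_of_witnessNum_eq_succ {φ : CTLStar I O .path} {n : Node I} {j : Fin k}
    (h : witnessNum l D φ n = j.succ) : Sat l φ (follow (fun x => D x j) n) := by
  unfold witnessNum at h
  split_ifs at h with hex
  · rw [← Fin.succ_injective _ h]
    exact hex.choose_spec
  · exact absurd h.symm (Fin.succ_ne_zero j)

theorem HasWitnessDirections.witnessNum_ne_zero_iff (hD : HasWitnessDirections Φ l D)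
    {φ : CTLStar I O .path} (hφ : φ ∈ existSub Φ) {n : Node I} :
    witnessNum l D φ n ≠ 0 ↔ Sat l (.ex φ) n := by
  constructor
  · intro h
    obtain ⟨j, hj⟩ := Fin.exists_succ_eq.2 h
    exact ⟨_, isTreePath_follow _ _, rfl, sat_follow_of_witnessNum_eq_succ hj.symm⟩
  · intro h
    rw [witnessNum, dif_pos (hD φ hφ n h)]
    exact Fin.succ_ne_zero _

open Classical in
/-- The tree labelled with the extended outputs that is determined by the tree `l` and the
direction labellings `D · j`. -/
noncomputable def extTree (Φ : CTLStar I O .state) (l : CompTree I (Set O))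
    (D : Node I → Fin k → Set I) : CompTree I (∀ o : ExtOut Φ k, o.dom) := fun n o =>
  match o with
  | .orig o => decide (o ∈ l n)
  | .univ φ => decide (Sat l (.all φ.1) n)
  | .exist φ => witnessNum l D φ.1 n
  | .dir j i => decide (i ∈ D n j)

theorem storedDir_extTree (j : Fin k) : storedDir (extTree Φ l D) j = fun n => D n j := by
  classical
  ext n i
  exact decide_eq_true_iff

theorem origTree_extTree : origTree (extTree Φ l D) = l := by
  classical
  ext n o
  exact decide_eq_true_iff

theorem HasWitnessDirections.sat_prime_extTree_iff (hD : HasWitnessDirections Φ l D) {s : Kind}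
    {ψ : CTLStar I O s} (h₁ : existSub ψ ⊆ existSub Φ) (h₂ : univSub ψ ⊆ univSub Φ)
    {π : ℕ → Node I} (hπ : IsTreePath π) :
    (prime Φ k ψ).Sat (trace (extTree Φ l D) π) ↔ Sat l ψ (pointOf π s) := by
  classical
  have henc := isEncoding_trace (extTree Φ l D)
  rw [origTree_extTree] at henc
  refine henc.sat_replace_iff ψ (fun φ hφ π _ => ?_) (fun φ hφ π _ => ?_) π hπ
  · rw [dif_pos (h₂ hφ)]
    exact decide_eq_true_iff
  · rw [dif_pos (h₁ hφ)]
    exact hD.witnessNum_ne_zero_iff (h₁ hφ)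

theorem HasWitnessDirections.realisable_toLTL [Fintype I] (hD : HasWitnessDirections Φ l D)
    (h : Sat l Φ []) : (toLTL Φ k).Realisable := by
  classical
  refine realisable_toLTL_iff.2 ⟨extTree Φ l D, fun π hπ h₀ => ?_, fun φ j n hj => ?_,
    fun φ π hπ hp => ?_⟩
  · refine (hD.sat_prime_extTree_iff subset_rfl subset_rfl hπ).2 ?_
    rwa [pointOf, h₀]
  · obtain ⟨h₁, h₂⟩ := (sub_of_mem_sub Φ).1 φ.1 φ.2
    rw [storedDir_extTree]
    exact (hD.sat_prime_extTree_iff h₁ h₂ (isTreePath_follow _ _)).2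
      (sat_follow_of_witnessNum_eq_succ hj)
  · obtain ⟨h₁, h₂⟩ := (sub_of_mem_sub Φ).2 φ.1 φ.2
    have hall : Sat l (.all φ.1) (π 0) := decide_eq_true_iff.1 hp
    exact (hD.sat_prime_extTree_iff h₁ h₂ hπ).2 (hall π hπ rfl)

end Completeness

end CTLStar

end CTLStarSynthesis

open CTLStarSynthesis in
theorem theorem1_general {I : Type*} {O : Type*} [Fintype I] (Φ : CTLStar I O .state)
    {Q : {φ // φ ∈ Φ.existSub} → Type*} [∀ φ, Fintype (Q φ)]
    (A : ∀ φ : {φ // φ ∈ Φ.existSub}, NBW (Set Φ.AutProp) (Q φ))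
    (hA : ∀ (φ : {φ // φ ∈ Φ.existSub}) (σ : ℕ → Set Φ.AutProp),
      (A φ).Accepts σ ↔ (Φ.autFormula φ.1).Sat σ)
    (k : ℕ) (hk : ∑ φ, Fintype.card (Q φ) ≤ k) :
    Φ.Realisable ↔ (Φ.toLTL k).Realisable := by
  refine ⟨?_, CTLStar.realisable_of_realisable_toLTL⟩
  rintro ⟨l, hl⟩
  obtain ⟨D, hD⟩ := CTLStar.exists_hasWitnessDirections A hA hk l
  exact hD.realisable_toLTL hl

open CTLStarSynthesis in
theorem theorem1 {I : Type*} {O : Type*} [Fintype I] (Φ : CTLStar I O .state)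
    {Q : {φ // φ ∈ Φ.existSub} → Type*} [∀ φ, Fintype (Q φ)]
    (A : ∀ φ : {φ // φ ∈ Φ.existSub}, NBW (Set Φ.AutProp) (Q φ))
    (hA : ∀ (φ : {φ // φ ∈ Φ.existSub}) (σ : ℕ → Set Φ.AutProp),
      (A φ).Accepts σ ↔ (Φ.autFormula φ.1).Sat σ)
    (k : ℕ) (hk : k = ∑ φ, Fintype.card (Q φ)) :
    Φ.Realisable ↔ (Φ.toLTL k).Realisable :=
  theorem1_general Φ A hA k hk.ge
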